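/- Let $\mathcal H$ be a real Hilbert space and $n\ge 2$. Let $A_1,\dots,A_n:\mathcal H\rightrightarrows\mathcal H$ be maximally monotone, let $\beta>0$, and let $B_1,\dots,B_{n-1}:\mathcal H\to\mathcal H$ be $\beta$-cocoercive, i.e. $\langle B_i(x)-B_i(y),x-y\rangle\ge\beta\|B_i(x)-B_i(y)\|^2$ for all $x,y$. Write $\operatorname{zer}T=\{x:0\in T(x)\}$ and suppose that $\operatorname{zer}\big(\sum_{i=1}^nA_i+\sum_{i=1}^{n-1}B_i\big)\ne\varnothing$. Let $G=(\mathcal N,\mathcal E)$, $G'=(\mathcal N,\mathcal E')$, $G''=(\mathcal N,\mathcal E'')$ be directed graphs on $\mathcal N=\{1,\dots,n\}$ with $\mathcal E',\mathcal E''\subseteq\mathcal E$ such that: every $(i,j)\in\mathcal E$ satisfies $i<j$; $G$ and $G'$ are weakly connected; and in $G''$ every node $i\ge2$ has in-degree $1$. For a graph $F$ on $\mathcal N$ let $\operatorname{Adj}(F)$ be its adjacency matrix ($\operatorname{Adj}(F)_{ij}=1$ if $(i,j)$ is an edge of $F$, and $0$ otherwise), $\operatorname{Deg}(F)$ the diagonal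 matrix of total degrees (in-degree plus out-degree), $\operatorname{Inc}(F)$ its incidence matrix ($\operatorname{Inc}(F)_{ie}=1$ if the edge $e$ leaves $i$, $-1$ if $e$ enters $i$, and $0$ otherwise), and set $$\operatorname{Lap}(F)=\operatorname{Inc}(F)\operatorname{Inc}(F)^*,\quad P(F)=\operatorname{Deg}(F)-2\operatorname{Adj}(F)^*,\quad Q(F)=\operatorname{Adj}(F)-\operatorname{Adj}(F)^*.$$ Put $\overline{G'}=(\mathcal N,\mathcal E\setminus\mathcal E')$ and let $Z\in\mathbb R^{n\times(n-1)}$ be any matrix with $\operatorname{Lap}(G')=ZZ^*$. Let $\mathcal P=P(\overline{G'})\otimes\operatorname{Id}_{\mathcal H}$, $\mathcal Q=Q(G')\otimes\operatorname{Id}_{\mathcal H}$, $\mathcal R=P(G)\otimes\operatorname{Id}_{\mathcal H}$, $\mathcal Z=Z\otimes\operatorname{Id}_{\mathcal H}$, $\mathcal A_D=\operatorname{diag}(A_1,\dots,A_n)$ and $\mathcal B_D=\operatorname{diag}(0,B_1,\dots,B_{n-1})\,(\operatorname{Adj}(G'')^*\otimes\operatorname{Id}_{\mathcal H})$. For $\tau>0$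 define on the product Hilbert space $\mathcal H^{2n-1}=\mathcal H^n\times\mathcal H^{n-1}$ the operators $$\mathcal A=\begin{bmatrix}\tau\mathcal A_D+\mathcal P+\mathcal Q&-\mathcal Z\\ \mathcal Z^*&0\end{bmatrix},\qquad \mathcal B=\begin{bmatrix}\tau\mathcal B_D+\frac{\tau}{4\beta}\mathcal R&0\\0&0\end{bmatrix}.$$ Then, for every $\mathbf x=[x_1,\dots,x_n]\in\mathcal H^n$, $$\exists\,\mathbf v\in\mathcal H^{n-1}:\ [\mathbf x,\mathbf v]\in\operatorname{zer}(\mathcal A+\mathcal B)\iff x_1=\dots=x_n\in\operatorname{zer}\Big(\sum_{i=1}^nA_i+\sum_{i=1}^{n-1}B_i\Big).$$ Moreover, $\mathcal A+\mathcal B$ is maximally monotone. -/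

import Mathlib

open scoped Pointwise

noncomputable section

namespace GraphFB

/-! ### Set-valued operators

A set-valued operator on `E` is a map `E → Set E`. Sums of set-valued operators are the pointwise
Minkowski sums (the addition of `E → Set E` under `open scoped Pointwise`). -/

section Operators

variable {E : Type*}

/-- A single-valued operator, regarded as a set-valued one. -/
def ofFun (B : E → E) : E → Set E := fun x => {B x}

/-- The zeros of a set-valued operator. -/
def zer [Zero E] (A : E → Set E) : Set E := {x | 0 ∈ A x}

variable [NormedAddCommGroup E] [InnerProductSpace ℝ E]

/-- `⟨x - y, u - v⟩ ≥ 0` for all `(x, u)`, `(y, v)` in the graph of `A`. -/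
def IsMonotone (A : E → Set E) : Prop :=
  ∀ x y u v : E, u ∈ A x → v ∈ A y → 0 ≤ inner ℝ (x - y) (u - v)

/-- `A` is monotone and every monotone operator whose graph contains that of `A` equals `A`. -/
def IsMaximallyMonotone (A : E → Set E) : Prop :=
  IsMonotone A ∧ ∀ A' : E → Set E, IsMonotone A' → (∀ x, A x ⊆ A' x) → A = A'

/-- `β`-cocoercivity of a single-valued operator. -/
def IsCocoercive (β : ℝ) (B : E → E) : Prop :=
  ∀ x y : E, β * ‖B x - B y‖ ^ 2 ≤ inner ℝ (B x - B y) (x - y)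

end Operators

/-! ### Directed graphs on `Fin n` and their matrices -/

section Graphs

variable {n : ℕ}

/-- Weak connectedness: any two nodes are joined by a path that ignores the edge orientations. -/
def IsConnected (G : Digraph (Fin n)) : Prop := G.toSimpleGraphInclusive.Connected

/-- Algorithmic graph: at least two nodes, edges go from smaller to larger nodes, connected. -/
def IsAlgorithmic (G : Digraph (Fin n)) : Prop :=
  2 ≤ n ∧ (∀ i j, G.Adj i j → i < j) ∧ IsConnected G

/-- The number of edges that enter `i`. -/
def inDeg (G : Digraph (Fin n)) (i : Fin n) : ℕ := {j | G.Adj j i}.ncard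

/-- The number of edges that leave `i`. -/
def outDeg (G : Digraph (Fin n)) (i : Fin n) : ℕ := {j | G.Adj i j}.ncard

open Classical in
/-- The adjacency matrix of a directed graph. -/
def adj (G : Digraph (Fin n)) : Matrix (Fin n) (Fin n) ℝ :=
  Matrix.of fun i j => if G.Adj i j then 1 else 0

/-- The degree matrix: the diagonal matrix of total degrees. -/
def deg (G : Digraph (Fin n)) : Matrix (Fin n) (Fin n) ℝ :=
  Matrix.diagonal fun i => ((inDeg G i + outDeg G i : ℕ) : ℝ)

/-- The edges of a directed graph, as pairs (tail, head). -/
abbrev Edge (G : Digraph (Fin n)) : Type := {e : Fin n × Fin n // G.Adj e.1 e.2}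

instance (G : Digraph (Fin n)) : Fintype (Edge G) := Fintype.ofFinite _

/-- The incidence matrix (of an oriented graph): `1` if `e` leaves `i`, `-1` if `e` enters `i`. -/
def inc (G : Digraph (Fin n)) : Matrix (Fin n) (Edge G) ℝ :=
  Matrix.of fun i e => if e.1.1 = i then 1 else if e.1.2 = i then -1 else 0

/-- The Laplacian matrix (of an oriented graph). -/
def lap (G : Digraph (Fin n)) : Matrix (Fin n) (Fin n) ℝ := inc G * (inc G).transpose

/-- `P(G) = Deg(G) - 2 Adj(G)ᵀ`. -/
def matP (G : Digraph (Fin n)) : Matrix (Fin n) (Fin n) ℝ := deg G - (2 : ℝ) • (adj G).transpose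

/-- `Q(G) = Adj(G) - Adj(G)ᵀ`. -/
def matQ (G : Digraph (Fin n)) : Matrix (Fin n) (Fin n) ℝ := adj G - (adj G).transpose

end Graphs

/-! ### The lifted operators -/

section Lifted

/-- The product Hilbert space `Hᵏ`, with inner product `∑ i, ⟨x i, y i⟩`. -/
abbrev Pow (H : Type*) (k : ℕ) : Type _ := PiLp 2 (fun _ : Fin k => H)

/-- The product Hilbert space `Hⁿ × Hⁿ⁻¹ = H²ⁿ⁻¹`, with the sum of the inner products. -/
abbrev Lifted (H : Type*) (n : ℕ) : Type _ := WithLp 2 (Pow H n × Pow H (n - 1))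

variable {H : Type*} [NormedAddCommGroup H] [InnerProductSpace ℝ H] {n : ℕ}

/-- `M ⊗ Id` acting on a product space: the `i`-th entry is `∑ j, M i j • x j`. -/
def kron {k l : ℕ} (M : Matrix (Fin k) (Fin l) ℝ) (x : Pow H l) : Pow H k :=
  WithLp.toLp 2 fun i => ∑ j, M i j • x j

/-- `diag(A₁, …, Aₙ)`, as a set-valued operator on `Hⁿ`. -/
def diagA (A : Fin n → H → Set H) (x : Pow H n) : Set (Pow H n) := {a | ∀ i, a i ∈ A i (x i)}

/-- `diag(0, B₁, …, Bₙ₋₁)` on `Hⁿ`. With nodes counted from `0`, node `i ≥ 1` carries the operator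
with index `i - 1`. -/
def diagB (B : Fin (n - 1) → H → H) (x : Pow H n) : Pow H n :=
  WithLp.toLp 2 fun i => if h : i.val = 0 then 0 else B ⟨i.val - 1, by omega⟩ (x i)

/-- `B_D = diag(0, B₁, …, Bₙ₋₁) ∘ (Adj(G'')ᵀ ⊗ Id)`. -/
def opBD (G'' : Digraph (Fin n)) (B : Fin (n - 1) → H → H) (x : Pow H n) : Pow H n :=
  diagB B (kron (adj G'').transpose x)

/-- The lifted set-valued operator: at `[x, v]` it consists of all
`[τ a + (P(G \ G') ⊗ Id) x + (Q(G') ⊗ Id) x - (Z ⊗ Id) v, (Zᵀ ⊗ Id) x]` with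
`a ∈ A₁(x₁) × ⋯ × Aₙ(xₙ)`. -/
def liftA (τ : ℝ) (G G' : Digraph (Fin n)) (Z : Matrix (Fin n) (Fin (n - 1)) ℝ)
    (A : Fin n → H → Set H) (u : Lifted H n) : Set (Lifted H n) :=
  {w | ∃ a ∈ diagA A u.fst,
    w = WithLp.toLp 2
      (τ • a + kron (matP (G \ G')) u.fst + kron (matQ G') u.fst - kron Z u.snd,
        kron Z.transpose u.fst)}

/-- The lifted single-valued operator
`[x, v] ↦ [τ B_D(x) + (τ / (4 β)) (P(G) ⊗ Id) x, 0]`. -/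
def liftB (τ β : ℝ) (G G'' : Digraph (Fin n)) (B : Fin (n - 1) → H → H) (u : Lifted H n) :
    Lifted H n :=
  WithLp.toLp 2 (τ • opBD G'' B u.fst + (τ / (4 * β)) • kron (matP G) u.fst, 0)

end Lifted

end GraphFB

end

namespace GraphFB

/-! ### Maximally monotone operators: Minty's theorem and Lipschitz perturbations -/

/-! Zeros. The second row of the inclusion is `Zᵀ x = 0`. Since `Z Zᵀ` is the Laplacian of the
connected graph `G'`, the kernel of `Zᵀ` is the constants, so `x` is a consensus vector. The range
of `Z` is the orthogonal complement of that kernel, so the first row is solvable in `v` exactly when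
the remaining terms sum to zero over the nodes. At consensus the `P` and `Q` terms contribute
nothing to that sum, because the entries of these matrices total zero; what is left is `τ` times the
original inclusion.

Maximality. The operator is `τ diag(A)`, extended by zero, plus a single-valued map. That map is
Lipschitz and monotone: `Q(G')` and the `Z` blocks are skew, `P` has quadratic form `∑ ‖x i - x j‖²`
over the edges, and the form of `P(G)`, weighted by `1 / (4 β)`, compensates for evaluating each
cocoercive operator at a predecessor's coordinate instead of at its own. A Lipschitz monotone
perturbation preserves maximality by Minty's characterisation and a Banach fixed point; Minty's
theorem itself comes from minimising a quadratic over the Fitzpatrick epigraph. -/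

theorem mem_add_ofFun {E : Type*} [AddCommGroup E] {S : E → Set E} {C : E → E} {x w : E} :
    w ∈ (S + ofFun C) x ↔ w - C x ∈ S x := by
  simp only [Pi.add_apply, ofFun, Set.add_singleton, Set.mem_image]
  constructor
  · rintro ⟨s, hs, rfl⟩
    simpa using hs
  · exact fun h => ⟨_, h, sub_add_cancel _ _⟩

section Minty

variable {E : Type*} [NormedAddCommGroup E] [InnerProductSpace ℝ E]

/-- Adjoining the point `(x, u)` to the graph keeps it monotone, so maximality says that it was
already there. -/
theorem IsMaximallyMonotone.mem_of_forall {A : E → Set E} (hA : IsMaximallyMonotone A) {x u : E}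
    (h : ∀ y v, v ∈ A y → 0 ≤ inner ℝ (x - y) (u - v)) : u ∈ A x := by
  have key := hA.2 (fun z => A z ∪ {w | z = x ∧ w = u}) ?_ (fun z => Set.subset_union_left)
  · rw [key]
    exact Or.inr ⟨rfl, rfl⟩
  · rintro y z v w (hv | ⟨rfl, rfl⟩) (hw | ⟨rfl, rfl⟩)
    · exact hA.1 _ _ _ _ hv hw
    · have := h y v hv
      rwa [← neg_sub y, ← neg_sub v, inner_neg_neg] at this
    · exact h _ _ hw
    · simp

theorem IsMonotone.isMaximallyMonotone {A : E → Set E} (hA : IsMonotone A)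
    (h : ∀ x u, (∀ y v, v ∈ A y → 0 ≤ inner ℝ (x - y) (u - v)) → u ∈ A x) :
    IsMaximallyMonotone A := by
  refine ⟨hA, fun A' hA' hsub => funext fun x => (hsub x).antisymm fun u hu => ?_⟩
  exact h x u fun y v hv => hA' x y u v hu (hsub y hv)

theorem IsMaximallyMonotone.exists_mem {A : E → Set E} (hA : IsMaximallyMonotone A) :
    ∃ y v, v ∈ A y := by
  by_contra! h
  exact h 0 0 (hA.mem_of_forall fun y v hv => absurd hv (h y v))

/-- The epigraph of the Fitzpatrick function of `A`. -/
def fitzpatrickEpi (A : E → Set E) : Set (E × E × ℝ) :=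
  {p | ∀ y v, v ∈ A y → inner ℝ p.1 v + inner ℝ y p.2.1 - inner ℝ y v ≤ p.2.2}

theorem convex_fitzpatrickEpi (A : E → Set E) : Convex ℝ (fitzpatrickEpi A) := by
  rintro ⟨x, u, s⟩ hp ⟨x', u', s'⟩ hq a b ha hb hab y v hv
  have h1 := mul_le_mul_of_nonneg_left (hp y v hv) ha
  have h2 := mul_le_mul_of_nonneg_left (hq y v hv) hb
  simp only [Prod.smul_mk, Prod.mk_add_mk, inner_add_left, inner_add_right, inner_smul_left,
    inner_smul_right, smul_eq_mul, conj_trivial] at h1 h2 ⊢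
  have h3 : inner ℝ y v = a * inner ℝ y v + b * inner ℝ y v := by rw [← add_mul, hab, one_mul]
  linarith

theorem isClosed_fitzpatrickEpi (A : E → Set E) : IsClosed (fitzpatrickEpi A) := by
  simp only [fitzpatrickEpi, Set.ofPred_forall]
  refine isClosed_iInter fun y => isClosed_iInter fun v => isClosed_iInter fun _ => ?_
  exact isClosed_le (by fun_prop) (by fun_prop)

theorem IsMonotone.mem_fitzpatrickEpi {A : E → Set E} (hA : IsMonotone A) {x u : E}
    (hu : u ∈ A x) : (x, u, inner ℝ x u) ∈ fitzpatrickEpi A := by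
  intro y v hv
  have := hA x y u v hu hv
  simp only [inner_sub_left, inner_sub_right] at this ⊢
  linarith

/-- A point violating the bound would be monotonically related to the whole graph, hence lie on it;
testing the epigraph condition at that very point then gives the bound. -/
theorem IsMaximallyMonotone.inner_le_of_mem_fitzpatrickEpi {A : E → Set E}
    (hA : IsMaximallyMonotone A) {p : E × E × ℝ} (hp : p ∈ fitzpatrickEpi A) :
    inner ℝ p.1 p.2.1 ≤ p.2.2 := by
  by_contra! hlt
  have hmem : p.2.1 ∈ A p.1 := hA.mem_of_forall fun y v hv => by
    have := hp y v hv
    simp only [inner_sub_left, inner_sub_right]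
    linarith
  have := hp _ _ hmem
  linarith

/-- The function `t + ‖x‖² / 2 + ‖u‖² / 2`, whose minimum over the Fitzpatrick epigraph yields
Minty's theorem. -/
noncomputable def mintyCost (p : E × E × ℝ) : ℝ := p.2.2 + (‖p.1‖ ^ 2 + ‖p.2.1‖ ^ 2) / 2

/-- The exact strong-convexity defect in the two vector coordinates. It makes minimising sequences
Cauchy and gives quadratic growth at a minimiser. -/
theorem mintyCost_add_smul (p q : E × E × ℝ) (s : ℝ) :
    mintyCost ((1 - s) • p + s • q) = (1 - s) * mintyCost p + s * mintyCost q
      - s * (1 - s) * (‖p.1 - q.1‖ ^ 2 + ‖p.2.1 - q.2.1‖ ^ 2) / 2 := by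
  obtain ⟨x, u, a⟩ := p
  obtain ⟨y, v, b⟩ := q
  simp only [mintyCost, Prod.smul_mk, Prod.mk_add_mk, smul_eq_mul, norm_add_sq_real,
    norm_sub_sq_real, norm_smul, inner_smul_left, inner_smul_right, mul_pow, Real.norm_eq_abs,
    sq_abs, conj_trivial]
  ring

/-- A closed convex set on which `mintyCost` is bounded below contains a minimiser. -/
theorem exists_isMinOn_mintyCost [CompleteSpace E] {C : Set (E × E × ℝ)} (hne : C.Nonempty)
    (hconv : Convex ℝ C) (hcl : IsClosed C) (hbdd : ∀ p ∈ C, 0 ≤ mintyCost p) :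
    ∃ p ∈ C, ∀ q ∈ C, mintyCost p ≤ mintyCost q := by
  set m := sInf (mintyCost '' C) with hm
  have hlow : ∀ q ∈ C, m ≤ mintyCost q := fun q hq =>
    csInf_le ⟨0, by rintro _ ⟨p, hp, rfl⟩; exact hbdd p hp⟩ ⟨q, hq, rfl⟩
  have hex : ∀ k : ℕ, ∃ p ∈ C, mintyCost p < m + 1 / ((k : ℝ) + 1) := fun k => by
    obtain ⟨_, ⟨p, hp, rfl⟩, h⟩ := exists_lt_of_csInf_lt (hne.image mintyCost)
      (lt_add_of_pos_right m (Nat.one_div_pos_of_nat (n := k) (α := ℝ)))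
    exact ⟨p, hp, h⟩
  choose p hpC hp using hex
  -- The midpoint costs at least `m`, and the defect at `s = 1 / 2` is one eighth of the squared
  -- distance; hence the factor 8.
  have hdist : ∀ k l N : ℕ, N ≤ k → N ≤ l →
      ‖(p k).1 - (p l).1‖ ^ 2 + ‖(p k).2.1 - (p l).2.1‖ ^ 2 ≤ 8 * (1 / ((N : ℝ) + 1)) := by
    intro k l N hk hl
    have h1 := hlow _ (hconv (hpC k) (hpC l) (a := 1 - 1 / 2) (b := 1 / 2) (by norm_num)
      (by norm_num) (by norm_num))
    rw [mintyCost_add_smul] at h1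
    have h2 := (hp k).trans_le (add_le_add_right (Nat.one_div_le_one_div (α := ℝ) hk) m)
    have h3 := (hp l).trans_le (add_le_add_right (Nat.one_div_le_one_div (α := ℝ) hl) m)
    linarith
  have hlim : Filter.Tendsto (fun N : ℕ => √(8 * (1 / ((N : ℝ) + 1)))) Filter.atTop (nhds 0) := by
    have := (tendsto_one_div_add_atTop_nhds_zero_nat (𝕜 := ℝ)).const_mul 8
    simpa using this.sqrt
  have hc1 : CauchySeq fun k => (p k).1 := cauchySeq_of_le_tendsto_0 _ (fun k l N hk hl => by
    rw [dist_eq_norm]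
    exact Real.le_sqrt_of_sq_le (by nlinarith [hdist k l N hk hl])) hlim
  have hc2 : CauchySeq fun k => (p k).2.1 := cauchySeq_of_le_tendsto_0 _ (fun k l N hk hl => by
    rw [dist_eq_norm]
    exact Real.le_sqrt_of_sq_le (by nlinarith [hdist k l N hk hl])) hlim
  obtain ⟨x, hx⟩ := cauchySeq_tendsto_of_complete hc1
  obtain ⟨u, hu⟩ := cauchySeq_tendsto_of_complete hc2
  have hcost : Filter.Tendsto (fun k => mintyCost (p k)) Filter.atTop (nhds m) := by
    refine tendsto_of_tendsto_of_tendsto_of_le_of_le tendsto_const_nhds ?_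
      (fun k => hlow _ (hpC k)) (fun k => (hp k).le)
    simpa using (tendsto_one_div_add_atTop_nhds_zero_nat (𝕜 := ℝ)).const_add m
  -- The cost is only linear in the real coordinate, so its limit is recovered from those of the
  -- cost and the norms.
  have ht : Filter.Tendsto (fun k => (p k).2.2) Filter.atTop
      (nhds (m - (‖x‖ ^ 2 + ‖u‖ ^ 2) / 2)) := by
    refine (hcost.sub (((hx.norm.pow 2).add (hu.norm.pow 2)).div_const 2)).congr fun k => ?_
    simp [mintyCost]
  refine ⟨(x, u, m - (‖x‖ ^ 2 + ‖u‖ ^ 2) / 2), ?_, fun q hq => ?_⟩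
  · exact hcl.mem_of_tendsto (hx.prodMk_nhds (hu.prodMk_nhds ht)) (.of_forall hpC)
  · simpa [mintyCost] using hlow q hq

theorem IsMaximallyMonotone.exists_neg_mem [CompleteSpace E] {A : E → Set E}
    (hA : IsMaximallyMonotone A) : ∃ x, -x ∈ A x := by
  obtain ⟨y₀, v₀, h₀⟩ := hA.exists_mem
  obtain ⟨⟨x, u, t⟩, hp, hmin⟩ := exists_isMinOn_mintyCost ⟨_, hA.1.mem_fitzpatrickEpi h₀⟩
    (convex_fitzpatrickEpi A) (isClosed_fitzpatrickEpi A) fun p hp => by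
      have h1 := hA.inner_le_of_mem_fitzpatrickEpi hp
      have h2 := norm_add_sq_real p.1 p.2.1
      unfold mintyCost
      nlinarith [sq_nonneg ‖p.1 + p.2.1‖]
  have ht : inner ℝ x u ≤ t := hA.inner_le_of_mem_fitzpatrickEpi hp
  -- Move from the minimiser a fraction `s` towards a graph point, divide by `s` and let `s → 0`:
  -- the cost grows by at least `D / 2`. Expanding this and using `⟨x, u⟩ ≤ t` gives the claim.
  have key : ∀ y v, v ∈ A y → ‖x + u‖ ^ 2 ≤ inner ℝ (y + u) (v + x) := by
    intro y v hv
    set D := ‖x - y‖ ^ 2 + ‖u - v‖ ^ 2 with hD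
    set q : E × E × ℝ := (y, v, inner ℝ y v) with hq
    have hs : ∀ s : ℝ, 0 < s → s ≤ 1 →
        mintyCost (x, u, t) + (1 - s) * D / 2 ≤ mintyCost q := by
      intro s h0 h1
      have h2 := hmin _ (convex_fitzpatrickEpi A hp (hA.1.mem_fitzpatrickEpi hv)
        (sub_nonneg.2 h1) h0.le (by ring))
      rw [mintyCost_add_smul] at h2
      refine le_of_mul_le_mul_left ?_ h0
      linarith
    have hlim : mintyCost (x, u, t) + (1 - 0) * D / 2 ≤ mintyCost q := by
      have hc : Filter.Tendsto (fun s : ℝ => mintyCost (x, u, t) + (1 - s) * D / 2)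
          (nhdsWithin 0 (Set.Ioi 0)) (nhds (mintyCost (x, u, t) + (1 - 0) * D / 2)) :=
        (Continuous.tendsto (by fun_prop) 0).mono_left nhdsWithin_le_nhds
      refine le_of_tendsto hc ?_
      filter_upwards [Ioc_mem_nhdsGT (zero_lt_one (α := ℝ))] with s hs'
      exact hs s hs'.1 hs'.2
    simp only [mintyCost, hD, hq, norm_sub_sq_real] at hlim
    rw [norm_add_sq_real]
    simp only [inner_add_left, inner_add_right, real_inner_comm x y, real_inner_comm x u]
    linarith
  have hmem : -x ∈ A (-u) := hA.mem_of_forall fun y v hv => by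
    have := key y v hv
    rw [← neg_add', ← neg_add', inner_neg_neg, add_comm u, add_comm x]
    exact (sq_nonneg _).trans this
  -- Testing at `(-u, -x)` itself makes the right side vanish, so `u = -x`.
  have h0 := key _ _ hmem
  rw [neg_add_cancel, inner_zero_left] at h0
  have hxu : x + u = 0 := by
    rw [← norm_eq_zero]
    exact pow_eq_zero_iff two_ne_zero |>.1 (le_antisymm h0 (sq_nonneg _))
  rw [← eq_neg_of_add_eq_zero_left hxu] at hmem
  exact ⟨x, hmem⟩

/-- **Minty's theorem**: `A + μ Id` is surjective for maximally monotone `A` and `μ > 0`. -/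
theorem IsMaximallyMonotone.exists_sub_smul_mem [CompleteSpace E] {A : E → Set E}
    (hA : IsMaximallyMonotone A) {μ : ℝ} (hμ : 0 < μ) (z : E) : ∃ x, z - μ • x ∈ A x := by
  -- The operator `μ⁻¹ (A - z)` reduces the general case to `-x ∈ A x`.
  have hA' : IsMaximallyMonotone fun x => {w | z + μ • w ∈ A x} := by
    refine IsMonotone.isMaximallyMonotone (fun x y u v hu hv => ?_) fun x u h => ?_
    · have := hA.1 x y _ _ hu hv
      rw [add_sub_add_left_eq_sub, ← smul_sub, inner_smul_right] at this
      exact nonneg_of_mul_nonneg_right this hμ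
    · refine hA.mem_of_forall fun y v hv => ?_
      have := h y (μ⁻¹ • (v - z)) (by simpa [smul_smul, hμ.ne'] using hv)
      have h2 : z + μ • u - v = μ • (u - μ⁻¹ • (v - z)) := by
        rw [smul_sub, smul_inv_smul₀ hμ.ne']
        abel
      rw [h2, inner_smul_right]
      positivity
  obtain ⟨x, hx⟩ := hA'.exists_neg_mem
  exact ⟨x, by simpa [sub_eq_add_neg] using hx⟩

/-- If `(x, u)` is monotonically related to the graph, solve `u + μ x ∈ A y + μ y`; testing against
this `y` gives `-μ ‖x - y‖² ≥ 0`, so `y = x`. -/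
theorem IsMonotone.isMaximallyMonotone_of_surjective {A : E → Set E} (hA : IsMonotone A) {μ : ℝ}
    (hμ : 0 < μ) (h : ∀ z, ∃ x, z - μ • x ∈ A x) : IsMaximallyMonotone A := by
  refine hA.isMaximallyMonotone fun x u hxu => ?_
  obtain ⟨y, hy⟩ := h (u + μ • x)
  have h1 := hxu _ _ hy
  have h2 : u - (u + μ • x - μ • y) = -(μ • (x - y)) := by
    rw [smul_sub]
    abel
  rw [h2, inner_neg_right, inner_smul_right, real_inner_self_eq_norm_sq] at h1
  have h3 : ‖x - y‖ ^ 2 ≤ 0 := by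
    by_contra! h4
    have := mul_pos hμ h4
    linarith
  have h5 : x = y := by
    rw [← sub_eq_zero, ← norm_eq_zero]
    exact pow_eq_zero_iff two_ne_zero |>.1 (le_antisymm h3 (sq_nonneg _))
  subst h5
  simpa using hy

/-- A monotone operator all of whose resolvents have full domain stays maximally monotone after
adding a monotone Lipschitz operator. -/
theorem IsMonotone.isMaximallyMonotone_add_ofFun [CompleteSpace E] {S : E → Set E}
    (hS : IsMonotone S) (hsurj : ∀ μ : ℝ, 0 < μ → ∀ z, ∃ x, z - μ • x ∈ S x) {C : E → E}
    (hC : ∀ x y, 0 ≤ inner ℝ (x - y) (C x - C y)) {K : NNReal} (hK : LipschitzWith K C) :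
    IsMaximallyMonotone (S + ofFun C) := by
  have hmono : IsMonotone (S + ofFun C) := by
    intro x y u v hu hv
    rw [mem_add_ofFun] at hu hv
    have h1 := add_nonneg (hS x y _ _ hu hv) (hC x y)
    rw [← inner_add_right] at h1
    rwa [show u - C x - (v - C y) + (C x - C y) = u - v by abel] at h1
  -- The resolvent `J` is `μ⁻¹`-Lipschitz, so any `μ > K` makes `y ↦ J (z - C y)` a contraction; its
  -- fixed point solves the inclusion.
  set μ : NNReal := K + 1 with hμdef
  have hμ : (0 : ℝ) < μ := by positivity
  refine hmono.isMaximallyMonotone_of_surjective hμ fun z => ?_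
  choose J hJ using hsurj μ hμ
  have hJlip : LipschitzWith μ⁻¹ J := by
    refine LipschitzWith.of_dist_le_mul fun a b => ?_
    rw [dist_eq_norm, dist_eq_norm, NNReal.coe_inv, ← div_eq_inv_mul, le_div_iff₀ hμ]
    have h1 := hS _ _ _ _ (hJ a) (hJ b)
    have h2 : a - (μ : ℝ) • J a - (b - (μ : ℝ) • J b) = (a - b) - (μ : ℝ) • (J a - J b) := by
      rw [smul_sub]
      abel
    rw [h2, inner_sub_right, inner_smul_right, real_inner_self_eq_norm_sq] at h1
    have h3 := real_inner_le_norm (J a - J b) (a - b)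
    rcases (norm_nonneg (J a - J b)).eq_or_lt with h0 | h0
    · rw [← h0, zero_mul]
      exact norm_nonneg _
    · refine le_of_mul_le_mul_left ?_ h0
      nlinarith
  have hcontr : ContractingWith (μ⁻¹ * K) fun y => J (z - C y) := by
    refine ⟨?_, ?_⟩
    · rw [← div_eq_inv_mul, div_lt_one (by positivity)]
      exact lt_add_one K
    · refine hJlip.comp (LipschitzWith.of_dist_le_mul fun a b => ?_)
      rw [dist_sub_left]
      exact hK.dist_le_mul a b
  have hfix := hcontr.fixedPoint_isFixedPt
  refine ⟨ContractingWith.fixedPoint _ hcontr, mem_add_ofFun.2 ?_⟩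
  have h1 := hJ (z - C (ContractingWith.fixedPoint _ hcontr))
  have h2 : J (z - C (ContractingWith.fixedPoint _ hcontr)) = ContractingWith.fixedPoint _ hcontr :=
    hfix
  rw [h2] at h1
  rwa [sub_right_comm]

end Minty

end GraphFB

namespace GraphFB

/-! ### Matrices acting on product spaces -/

section Kron

variable {H : Type*} [NormedAddCommGroup H] [InnerProductSpace ℝ H] {k l m : ℕ}

@[simp]
theorem kron_apply (M : Matrix (Fin k) (Fin l) ℝ) (x : Pow H l) (i : Fin k) :
    kron M x i = ∑ j, M i j • x j := rfl

/-- `kron M` as a continuous linear map. -/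
noncomputable def kronL (M : Matrix (Fin k) (Fin l) ℝ) : Pow H l →L[ℝ] Pow H k where
  toFun := kron M
  map_add' x y := by
    ext i
    simp [Finset.sum_add_distrib]
  map_smul' c x := by
    ext i
    simp [Finset.smul_sum, smul_comm c]
  cont := by
    unfold kron
    fun_prop

theorem kron_sub (M : Matrix (Fin k) (Fin l) ℝ) (x y : Pow H l) :
    kron M (x - y) = kron M x - kron M y := (kronL M).map_sub x y

theorem kron_mul (M : Matrix (Fin k) (Fin l) ℝ) (N : Matrix (Fin l) (Fin m) ℝ) (x : Pow H m) :
    kron (M * N) x = kron M (kron N x) := by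
  ext i
  simp only [kron_apply, Matrix.mul_apply, Finset.sum_smul, Finset.smul_sum, smul_smul]
  exact Finset.sum_comm

theorem kron_add_matrix (M N : Matrix (Fin k) (Fin l) ℝ) (x : Pow H l) :
    kron (M + N) x = kron M x + kron N x := by
  ext i
  simp [add_smul, Finset.sum_add_distrib]

theorem kron_one (x : Pow H k) : kron 1 x = x := by
  ext i
  simp [Matrix.one_apply]

theorem inner_kron (M : Matrix (Fin k) (Fin l) ℝ) (x : Pow H k) (y : Pow H l) :
    inner ℝ x (kron M y) = ∑ i, ∑ j, M i j * inner ℝ (x i) (y j) := by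
  simp [PiLp.inner_apply, inner_sum, inner_smul_right]

theorem inner_kron_transpose (M : Matrix (Fin k) (Fin l) ℝ) (x : Pow H k) (y : Pow H l) :
    inner ℝ y (kron M.transpose x) = inner ℝ x (kron M y) := by
  rw [inner_kron, inner_kron, Finset.sum_comm]
  simp [real_inner_comm]

theorem sum_kron_const (M : Matrix (Fin k) (Fin l) ℝ) {x : Pow H l} {z : H} (hx : ∀ i, x i = z) :
    ∑ i, kron M x i = (∑ i, ∑ j, M i j) • z := by
  simp [hx, Finset.sum_smul]

theorem sum_kron_eq_zero {M : Matrix (Fin k) (Fin l) ℝ}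
    (hM : M.transpose.mulVec (fun _ => 1) = 0) (x : Pow H l) : ∑ i, kron M x i = 0 := by
  simp only [kron_apply]
  rw [Finset.sum_comm]
  refine Finset.sum_eq_zero fun j _ => ?_
  have h := congrFun hM j
  simp only [Matrix.mulVec, dotProduct, Matrix.transpose_apply, mul_one, Pi.zero_apply] at h
  rw [← Finset.sum_smul, h, zero_smul]

end Kron

/-! ### Matrices of directed graphs -/

section GraphMatrices

variable {n : ℕ} (F : Digraph (Fin n))

theorem adj_nonneg (i j : Fin n) : 0 ≤ adj F i j := by
  simp only [adj, Matrix.of_apply]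
  split_ifs <;> norm_num

theorem inDeg_eq_sum (i : Fin n) : (inDeg F i : ℝ) = ∑ j, adj F j i := by
  classical
  simp only [inDeg, adj, Matrix.of_apply, Finset.sum_boole]
  rw [← Set.ncard_coe_finset]
  simp

theorem outDeg_eq_sum (i : Fin n) : (outDeg F i : ℝ) = ∑ j, adj F i j := by
  classical
  simp only [outDeg, adj, Matrix.of_apply, Finset.sum_boole]
  rw [← Set.ncard_coe_finset]
  simp

theorem sum_sum_matP : ∑ i, ∑ j, matP F i j = 0 := by
  have h : ∑ i, ∑ j, adj F j i = ∑ i, ∑ j, adj F i j := Finset.sum_comm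
  simp only [matP, deg, Matrix.sub_apply, Matrix.diagonal_apply, Matrix.smul_apply,
    Matrix.transpose_apply, smul_eq_mul, Finset.sum_sub_distrib, Finset.sum_ite_eq,
    Finset.mem_univ, if_true, Nat.cast_add, inDeg_eq_sum, outDeg_eq_sum, Finset.sum_add_distrib,
    ← Finset.mul_sum, h]
  ring

theorem sum_sum_matQ : ∑ i, ∑ j, matQ F i j = 0 := by
  have h : ∑ i, ∑ j, adj F j i = ∑ i, ∑ j, adj F i j := Finset.sum_comm
  simp [matQ, Finset.sum_sub_distrib, h]

variable {H : Type*} [NormedAddCommGroup H] [InnerProductSpace ℝ H]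

theorem inner_kron_matP (x : Pow H n) :
    inner ℝ x (kron (matP F) x) = ∑ i, ∑ j, adj F i j * ‖x i - x j‖ ^ 2 := by
  have h1 : ∀ f : Fin n → Fin n → ℝ,
      ∑ i, ∑ j, adj F j i * f j i = ∑ i, ∑ j, adj F i j * f i j := fun f => Finset.sum_comm
  have h2 := h1 fun i j => inner ℝ (x j) (x i)
  have h3 := h1 fun _ i => ‖x i‖ ^ 2
  simp only [inner_kron, matP, deg, Matrix.sub_apply, Matrix.diagonal_apply, Matrix.smul_apply,
    Matrix.transpose_apply, smul_eq_mul, sub_mul, ite_mul, zero_mul, Finset.sum_sub_distrib,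
    Finset.sum_ite_eq, Finset.mem_univ, if_true, Nat.cast_add, inDeg_eq_sum, outDeg_eq_sum,
    norm_sub_sq_real, mul_add, mul_sub, Finset.sum_add_distrib, add_mul, Finset.sum_mul,
    real_inner_self_eq_norm_sq, h3, mul_left_comm _ (2 : ℝ), mul_assoc, ← Finset.mul_sum, h2]
  simp only [real_inner_comm]
  ring

theorem inner_kron_matQ (x : Pow H n) : inner ℝ x (kron (matQ F) x) = 0 := by
  have h : ∑ i, ∑ j, adj F j i * inner ℝ (x i) (x j) =
      ∑ i, ∑ j, adj F i j * inner ℝ (x i) (x j) := by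
    rw [Finset.sum_comm]
    simp only [real_inner_comm]
  simp only [inner_kron, matQ, Matrix.sub_apply, Matrix.transpose_apply, sub_mul,
    Finset.sum_sub_distrib, h, sub_self]

/-! ### Kernel of `Zᵀ` and range of `Z` -/

variable {F}

theorem inc_transpose_mulVec (hF : ∀ i j, F.Adj i j → i < j) (a : Fin n → ℝ) (e : Edge F) :
    (inc F).transpose.mulVec a e = a e.1.1 - a e.1.2 := by
  have hne := (hF _ _ e.2).ne
  have h : ∀ i, inc F i e * a i =
      (if e.1.1 = i then a i else 0) - if e.1.2 = i then a i else 0 := by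
    intro i
    simp only [inc, Matrix.of_apply]
    split_ifs with h1 h2 <;> simp
    exact absurd (h1.trans h2.symm) hne
  simp [Matrix.mulVec, dotProduct, h, Finset.sum_sub_distrib]

theorem apply_eq_of_isConnected (hF : IsConnected F) {X : Type*} {a : Fin n → X}
    (ha : ∀ i j, F.Adj i j → a i = a j) (i j : Fin n) : a i = a j := by
  obtain ⟨p⟩ := hF.preconnected i j
  induction p with
  | nil => rfl
  | cons h _ ih => exact (h.2.elim (ha _ _) fun h' => (ha _ _ h').symm).trans ih

/-- The kernel of `Mᵀ` is that of `M Mᵀ`, and `Z` and the incidence matrix share this product. -/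
theorem transpose_mulVec_eq_zero_iff {k : ℕ} {Z : Matrix (Fin n) (Fin k) ℝ}
    (hZ : lap F = Z * Z.transpose) (a : Fin n → ℝ) :
    Z.transpose.mulVec a = 0 ↔ (inc F).transpose.mulVec a = 0 := by
  have h1 := Matrix.self_mul_conjTranspose_mulVec_eq_zero Z a
  have h2 := Matrix.self_mul_conjTranspose_mulVec_eq_zero (inc F) a
  rw [Matrix.conjTranspose_eq_transpose_of_trivial] at h1 h2
  rw [← h1, ← h2, ← hZ, lap]

variable {k : ℕ} {Z : Matrix (Fin n) (Fin k) ℝ}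

theorem transpose_mulVec_eq_zero_iff_const (hF : ∀ i j, F.Adj i j → i < j) (hconn : IsConnected F)
    (hZ : lap F = Z * Z.transpose) (a : Fin n → ℝ) :
    Z.transpose.mulVec a = 0 ↔ ∀ i j, a i = a j := by
  rw [transpose_mulVec_eq_zero_iff hZ]
  constructor
  · intro h
    refine apply_eq_of_isConnected hconn fun i j hij => ?_
    have := congrFun h ⟨(i, j), hij⟩
    rwa [inc_transpose_mulVec hF, Pi.zero_apply, sub_eq_zero] at this
  · intro h
    ext e
    rw [inc_transpose_mulVec hF, h, sub_self, Pi.zero_apply]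

theorem kron_transpose_eq_zero_iff (hF : ∀ i j, F.Adj i j → i < j) (hconn : IsConnected F)
    (hZ : lap F = Z * Z.transpose) (x : Pow H n) :
    kron Z.transpose x = 0 ↔ ∀ i j, x i = x j := by
  have key := transpose_mulVec_eq_zero_iff_const hF hconn hZ
  constructor
  · intro h i j
    -- Pairing with an arbitrary `y` reduces to the scalar kernel.
    refine ext_inner_left ℝ fun y => ?_
    refine (key fun i => inner ℝ y (x i)).1 ?_ i j
    ext e
    have := congrArg (fun w : Pow H k => inner ℝ y (w e)) h
    simpa [inner_sum, inner_smul_right, Matrix.mulVec, dotProduct] using this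
  · intro h
    ext e
    rcases isEmpty_or_nonempty (Fin n) with hn | ⟨⟨i₀⟩⟩
    · simp
    · have h1 := congrFun ((key fun _ => 1).2 fun _ _ => rfl) e
      simp only [Matrix.mulVec, dotProduct, mul_one, Pi.zero_apply] at h1
      simp only [kron_apply, h _ i₀, ← Finset.sum_smul, h1, zero_smul, PiLp.zero_apply]

/-- The range of `Z ⊗ Id` contains all vectors whose entries sum to zero. -/
theorem exists_kron_eq (hn : n ≠ 0) (hF : ∀ i j, F.Adj i j → i < j) (hconn : IsConnected F)
    (hZ : lap F = Z * Z.transpose) {w : Pow H n} (hw : ∑ i, w i = 0) : ∃ v, kron Z v = w := by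
  have key := transpose_mulVec_eq_zero_iff_const hF hconn hZ
  have hone : Z.transpose.mulVec (fun _ => 1) = 0 := (key _).2 fun _ _ => rfl
  -- The all-ones matrix fills in the only direction that `Z Zᵀ` kills, so the sum is invertible.
  -- Its inverse writes `w` as a vector in the range of `Z` plus a constant one, and `∑ w i = 0`
  -- removes the constant.
  set J : Matrix (Fin n) (Fin n) ℝ := Matrix.of fun _ _ => 1 with hJ
  have hn' : (n : ℝ) ≠ 0 := Nat.cast_ne_zero.2 hn
  have hinj : Function.Injective (Z * Z.transpose + J).mulVec := by
    refine (injective_iff_map_eq_zero (Matrix.mulVecLin (Z * Z.transpose + J))).2 fun a ha => ?_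
    rw [Matrix.mulVecLin_apply, Matrix.add_mulVec] at ha
    have hJa : J.mulVec a = fun _ => ∑ i, a i := by
      ext i
      simp [hJ, Matrix.mulVec, dotProduct]
    have hsum : ∑ i, a i = 0 := by
      have h1 := congrArg (fun b => (fun _ : Fin n => (1 : ℝ)) ⬝ᵥ b) ha
      rw [hJa, dotProduct_add, ← Matrix.mulVec_mulVec, Matrix.dotProduct_mulVec,
        ← Matrix.mulVec_transpose, hone, zero_dotProduct, zero_add, dotProduct_zero] at h1
      simpa [dotProduct, hn'] using h1
    rw [hJa, hsum, show (fun _ : Fin n => (0 : ℝ)) = 0 from rfl, add_zero] at ha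
    have h2 : Z.transpose.mulVec a = 0 := by
      have := Matrix.self_mul_conjTranspose_mulVec_eq_zero Z a
      rw [Matrix.conjTranspose_eq_transpose_of_trivial] at this
      exact this.1 ha
    have h3 := (key a).1 h2
    ext i
    simp only [h3 _ i, Finset.sum_const, Finset.card_univ, Fintype.card_fin, nsmul_eq_mul] at hsum
    simpa [hn'] using hsum
  obtain ⟨N, hN⟩ := (Matrix.mulVec_injective_iff_isUnit.1 hinj).exists_right_inv
  have hdec : w = kron Z (kron Z.transpose (kron N w)) + kron J (kron N w) := by
    rw [← kron_mul, ← kron_add_matrix, ← kron_mul, hN, kron_one]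
  have hJy : ∀ i, kron J (kron N w) i = ∑ j, kron N w j := fun i => by simp [hJ]
  have hsum : ∑ j, kron N w j = 0 := by
    have h1 : ∑ i, (kron Z (kron Z.transpose (kron N w)) i + kron J (kron N w) i) = 0 := by
      rw [← hw]
      exact Finset.sum_congr rfl fun i _ => (congrArg (fun u : Pow H n => u i) hdec).symm
    rw [Finset.sum_add_distrib, sum_kron_eq_zero hone, zero_add] at h1
    simp only [hJy, Finset.sum_const, Finset.card_univ, Fintype.card_fin] at h1
    rw [← Nat.cast_smul_eq_nsmul ℝ] at h1
    exact (smul_eq_zero.1 h1).resolve_left hn'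
  refine ⟨_, Eq.symm (hdec.trans (add_eq_left.2 ?_))⟩
  ext i
  rw [hJy, hsum, PiLp.zero_apply]

end GraphMatrices

end GraphFB

namespace GraphFB

section Lifted

variable {H : Type*} [NormedAddCommGroup H] {n : ℕ}

/-! ### Decomposition of the lifted operator -/

theorem lifted_add (a b : Pow H n) (v w : Pow H (n - 1)) :
    (WithLp.toLp 2 (a, v) + WithLp.toLp 2 (b, w) : Lifted H n) = WithLp.toLp 2 (a + b, v + w) :=
  rfl

theorem lifted_sub (a b : Pow H n) (v w : Pow H (n - 1)) :
    (WithLp.toLp 2 (a, v) - WithLp.toLp 2 (b, w) : Lifted H n) = WithLp.toLp 2 (a - b, v - w) :=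
  rfl

variable [InnerProductSpace ℝ H]

theorem lifted_inner (u : Lifted H n) (a : Pow H n) (v : Pow H (n - 1)) :
    inner ℝ u (WithLp.toLp 2 (a, v)) = inner ℝ u.fst a + inner ℝ u.snd v :=
  WithLp.prod_inner_apply _ _

theorem lifted_inner_sub (u : Lifted H n) (a b : Pow H n) :
    inner ℝ u (WithLp.toLp 2 (a, 0) - WithLp.toLp 2 (b, 0)) = inner ℝ u.fst (a - b) := by
  rw [lifted_sub a b, lifted_inner, sub_self, inner_zero_right, add_zero]

/-- `τ • diag(A₁, …, Aₙ)` extended by zero to the product space. -/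
def liftDiag (τ : ℝ) (A : Fin n → H → Set H) (u : Lifted H n) : Set (Lifted H n) :=
  {w | ∃ a ∈ diagA A u.fst, w = WithLp.toLp 2 (τ • a, 0)}

/-- The linear part of the lifted operator. -/
noncomputable def liftLin (G G' : Digraph (Fin n)) (Z : Matrix (Fin n) (Fin (n - 1)) ℝ)
    (u : Lifted H n) : Lifted H n :=
  WithLp.toLp 2 (kron (matP (G \ G')) u.fst + kron (matQ G') u.fst - kron Z u.snd,
    kron Z.transpose u.fst)

theorem liftA_eq (τ : ℝ) (G G' : Digraph (Fin n)) (Z : Matrix (Fin n) (Fin (n - 1)) ℝ)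
    (A : Fin n → H → Set H) :
    liftA τ G G' Z A = liftDiag τ A + ofFun (liftLin G G' Z) := by
  ext u w
  rw [mem_add_ofFun]
  refine exists_congr fun a => and_congr_right fun _ => ?_
  have h : ∀ b : Lifted H n, w - liftLin G G' Z u = b ↔ w = b + liftLin G G' Z u :=
    fun b => sub_eq_iff_eq_add
  rw [h, liftLin, lifted_add, zero_add, ← add_sub_assoc, ← add_assoc]

theorem liftA_add_ofFun_liftB (τ β : ℝ) (G G' G'' : Digraph (Fin n))
    (Z : Matrix (Fin n) (Fin (n - 1)) ℝ) (A : Fin n → H → Set H) (B : Fin (n - 1) → H → H) :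
    liftA τ G G' Z A + ofFun (liftB τ β G G'' B) =
      liftDiag τ A + ofFun (fun u => liftLin G G' Z u + liftB τ β G G'' B u) := by
  rw [liftA_eq, add_assoc]
  congr 1
  ext u w
  rw [mem_add_ofFun]
  simp only [ofFun, Set.mem_singleton_iff]
  exact sub_eq_iff_eq_add

theorem isMonotone_liftDiag {τ : ℝ} (hτ : 0 ≤ τ) {A : Fin n → H → Set H}
    (hA : ∀ i, IsMonotone (A i)) : IsMonotone (liftDiag τ A) := by
  rintro x y _ _ ⟨a, ha, rfl⟩ ⟨b, hb, rfl⟩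
  rw [lifted_inner_sub, ← smul_sub, inner_smul_right, PiLp.inner_apply]
  exact mul_nonneg hτ (Finset.sum_nonneg fun i _ => hA i _ _ _ _ (ha i) (hb i))

theorem exists_sub_smul_mem_liftDiag [CompleteSpace H] {τ : ℝ} (hτ : 0 < τ)
    {A : Fin n → H → Set H} (hA : ∀ i, IsMaximallyMonotone (A i)) {μ : ℝ} (hμ : 0 < μ)
    (z : Lifted H n) : ∃ x, z - μ • x ∈ liftDiag τ A x := by
  -- Minty applies to each `A i` rather than `τ • A i`, so the data are divided by `τ`. On the
  -- second factor the operator is zero and one divides by `μ`.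
  choose x hx using fun i => (hA i).exists_sub_smul_mem (div_pos hμ hτ) (τ⁻¹ • z.fst i)
  refine ⟨WithLp.toLp 2 (WithLp.toLp 2 x, μ⁻¹ • z.snd),
    WithLp.toLp 2 fun i => τ⁻¹ • z.fst i - (μ / τ) • x i, hx, ?_⟩
  apply WithLp.ofLp_injective
  refine Prod.ext ?_ ?_
  · ext i
    simp [smul_sub, smul_smul, mul_div_cancel₀ _ hτ.ne', hτ.ne']
  · simp [smul_smul, hμ.ne']

/-! ### Monotonicity of the single-valued part -/

theorem liftLin_sub (G G' : Digraph (Fin n)) (Z : Matrix (Fin n) (Fin (n - 1)) ℝ)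
    (x y : Lifted H n) : liftLin G G' Z x - liftLin G G' Z y = liftLin G G' Z (x - y) := by
  simp only [liftLin, WithLp.sub_fst, WithLp.sub_snd, kron_sub, lifted_sub]
  congr 2
  abel

theorem inner_liftLin_nonneg (G G' : Digraph (Fin n)) (Z : Matrix (Fin n) (Fin (n - 1)) ℝ)
    (u : Lifted H n) : 0 ≤ inner ℝ u (liftLin G G' Z u) := by
  have h : inner ℝ u (liftLin G G' Z u) = inner ℝ u.fst (kron (matP (G \ G')) u.fst) := by
    simp only [liftLin, lifted_inner, inner_sub_right, inner_add_right, inner_kron_matQ,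
      inner_kron_transpose]
    ring
  rw [h, inner_kron_matP]
  exact Finset.sum_nonneg fun i _ => Finset.sum_nonneg fun j _ =>
    mul_nonneg (adj_nonneg _ _ _) (sq_nonneg _)

/-- The predecessor of a node with in-degree one. -/
theorem exists_adj_col_eq {F : Digraph (Fin n)} {i : Fin n} (h : inDeg F i = 1) :
    ∃ p, F.Adj p i ∧ ∀ j, adj F j i = if j = p then 1 else 0 := by
  obtain ⟨p, hp⟩ := Set.ncard_eq_one.1 h
  have hp' : ∀ j, F.Adj j i ↔ j = p := fun j => by
    simpa using Set.ext_iff.1 hp j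
  refine ⟨p, (hp' p).2 rfl, fun j => ?_⟩
  simp only [adj, Matrix.of_apply, hp']

theorem kron_adj_transpose_apply {F : Digraph (Fin n)} {i p : Fin n}
    (h : ∀ j, adj F j i = if j = p then 1 else 0) (x : Pow H n) :
    kron (adj F).transpose x i = x p := by
  simp [h]

theorem opBD_apply {F : Digraph (Fin n)} {i p : Fin n}
    (h : ∀ j, adj F j i = if j = p then 1 else 0) (hi : i.val ≠ 0) (B : Fin (n - 1) → H → H)
    (x : Pow H n) : opBD F B x i = B ⟨i.val - 1, by omega⟩ (x p) := by
  rw [← kron_adj_transpose_apply h]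
  exact dif_neg hi

/-- Write `d = (x - y) + (d - (x - y))`, apply cocoercivity to the first part and complete the
square. This is the source of the constant `1 / (4 β)`. -/
theorem IsCocoercive.neg_le_inner {β : ℝ} (hβ : 0 < β) {B : H → H} (hB : IsCocoercive β B)
    (x y d : H) : -(1 / (4 * β) * ‖x - y - d‖ ^ 2) ≤ inner ℝ d (B x - B y) := by
  have h1 := hB x y
  set b := B x - B y
  have h2 : 0 ≤ ‖b + (1 / (2 * β)) • (d - (x - y))‖ ^ 2 := sq_nonneg _
  rw [norm_add_sq_real, norm_smul, inner_smul_right, inner_sub_right, mul_pow, norm_sub_rev d,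
    Real.norm_eq_abs, sq_abs] at h2
  rw [real_inner_comm]
  have h3 := mul_nonneg hβ.le h2
  have h4 : β * (‖b‖ ^ 2 + 2 * (1 / (2 * β) * (inner ℝ b d - inner ℝ b (x - y))) +
      (1 / (2 * β)) ^ 2 * ‖x - y - d‖ ^ 2) = β * ‖b‖ ^ 2 + (inner ℝ b d - inner ℝ b (x - y)) +
      1 / (4 * β) * ‖x - y - d‖ ^ 2 := by
    field_simp
    ring
  linarith

theorem adj_mono {F G : Digraph (Fin n)} (h : F ≤ G) (i j : Fin n) : adj F i j ≤ adj G i j := by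
  simp only [adj, Matrix.of_apply]
  split_ifs with h1 h2
  · rfl
  · exact absurd (h h1) h2
  · exact zero_le_one
  · rfl

/-- Node by node: the operator at `i` sees the predecessor `p` but is paired with coordinate `i`.
The resulting error is absorbed by the edge `(p, i)`, which belongs to `G` as well. -/
theorem opBD_add_matP_monotone {β : ℝ} (hβ : 0 < β) {B : Fin (n - 1) → H → H}
    (hB : ∀ i, IsCocoercive β (B i)) {G G'' : Digraph (Fin n)} (hG'' : G'' ≤ G)
    (hin : ∀ i : Fin n, 1 ≤ i.val → inDeg G'' i = 1) (x y : Pow H n) :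
    0 ≤ inner ℝ (x - y) (opBD G'' B x - opBD G'' B y)
      + 1 / (4 * β) * inner ℝ (x - y) (kron (matP G) (x - y)) := by
  rw [inner_kron_matP, Finset.sum_comm, PiLp.inner_apply, Finset.mul_sum,
    ← Finset.sum_add_distrib]
  refine Finset.sum_nonneg fun i _ => ?_
  have hc : 0 < 1 / (4 * β) := by positivity
  have hnn : ∀ j, 0 ≤ adj G j i * ‖(x - y) j - (x - y) i‖ ^ 2 := fun j =>
    mul_nonneg (adj_nonneg _ _ _) (sq_nonneg _)
  by_cases hi : i.val = 0
  · have : (opBD G'' B x - opBD G'' B y) i = 0 := by simp [opBD, diagB, hi]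
    rw [this, inner_zero_right, zero_add]
    exact mul_nonneg hc.le (Finset.sum_nonneg fun j _ => hnn j)
  · obtain ⟨p, hp, hcol⟩ := exists_adj_col_eq (hin i (Nat.one_le_iff_ne_zero.2 hi))
    have h1 : (opBD G'' B x - opBD G'' B y) i =
        B ⟨i.val - 1, by omega⟩ (x p) - B ⟨i.val - 1, by omega⟩ (y p) := by
      rw [PiLp.sub_apply, opBD_apply hcol hi, opBD_apply hcol hi]
    have h2 := (hB ⟨i.val - 1, by omega⟩).neg_le_inner hβ (x p) (y p) ((x - y) i)
    have h3 : ‖x p - y p - (x - y) i‖ ^ 2 ≤ ∑ j, adj G j i * ‖(x - y) j - (x - y) i‖ ^ 2 := by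
      refine le_trans ?_ (Finset.single_le_sum (fun j _ => hnn j) (Finset.mem_univ p))
      have : 1 ≤ adj G p i := by simpa [hcol] using adj_mono hG'' p i
      rw [← PiLp.sub_apply]
      exact le_mul_of_one_le_left (sq_nonneg _) this
    rw [h1]
    linarith [mul_le_mul_of_nonneg_left h3 hc.le]

theorem liftB_monotone {τ β : ℝ} (hτ : 0 ≤ τ) (hβ : 0 < β) {B : Fin (n - 1) → H → H}
    (hB : ∀ i, IsCocoercive β (B i)) {G G'' : Digraph (Fin n)} (hG'' : G'' ≤ G)
    (hin : ∀ i : Fin n, 1 ≤ i.val → inDeg G'' i = 1) (x y : Lifted H n) :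
    0 ≤ inner ℝ (x - y) (liftB τ β G G'' B x - liftB τ β G G'' B y) := by
  have h := mul_nonneg hτ (opBD_add_matP_monotone hβ hB hG'' hin x.fst y.fst)
  have h1 : inner ℝ (x - y) (liftB τ β G G'' B x - liftB τ β G G'' B y) =
      inner ℝ (x.fst - y.fst) ((τ • opBD G'' B x.fst + (τ / (4 * β)) • kron (matP G) x.fst) -
        (τ • opBD G'' B y.fst + (τ / (4 * β)) • kron (matP G) y.fst)) := by
    rw [liftB, liftB, lifted_inner_sub, WithLp.sub_fst]
  rw [h1, add_sub_add_comm, ← smul_sub, ← smul_sub, ← kron_sub, inner_add_right, inner_smul_right,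
    inner_smul_right]
  calc 0 ≤ _ := h
    _ = _ := by ring

/-! ### Lipschitz continuity of the single-valued part -/

theorem IsCocoercive.norm_sub_le {β : ℝ} (hβ : 0 < β) {B : H → H} (hB : IsCocoercive β B)
    (x y : H) : ‖B x - B y‖ ≤ β⁻¹ * ‖x - y‖ := by
  rw [← div_eq_inv_mul, le_div_iff₀ hβ]
  have h1 := (hB x y).trans (real_inner_le_norm _ _)
  rcases (norm_nonneg (B x - B y)).eq_or_lt with h0 | h0
  · rw [← h0, zero_mul]
    exact norm_nonneg _
  · refine le_of_mul_le_mul_left ?_ h0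
    linarith

theorem lipschitzWith_diagB {β : NNReal} (hβ : 0 < β) {B : Fin (n - 1) → H → H}
    (hB : ∀ i, IsCocoercive β (B i)) : LipschitzWith β⁻¹ (diagB B : Pow H n → Pow H n) := by
  refine LipschitzWith.of_dist_le_mul fun x y => ?_
  rw [dist_eq_norm, dist_eq_norm]
  refine le_of_sq_le_sq ?_ (by positivity)
  rw [mul_pow, PiLp.norm_sq_eq_of_L2, PiLp.norm_sq_eq_of_L2, Finset.mul_sum]
  refine Finset.sum_le_sum fun i _ => ?_
  by_cases hi : i.val = 0
  · simp only [PiLp.sub_apply, diagB, hi, dif_pos, sub_self, norm_zero]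
    rw [zero_pow two_ne_zero]
    positivity
  · rw [← mul_pow]
    refine pow_le_pow_left₀ (norm_nonneg _) ?_ 2
    simpa [diagB, hi] using (hB ⟨i.val - 1, by omega⟩).norm_sub_le (NNReal.coe_pos.2 hβ) (x i) (y i)

theorem exists_lipschitzWith_liftLin_add_liftB (τ : ℝ) {β : ℝ} (hβ : 0 < β)
    (G G' G'' : Digraph (Fin n)) (Z : Matrix (Fin n) (Fin (n - 1)) ℝ) {B : Fin (n - 1) → H → H}
    (hB : ∀ i, IsCocoercive β (B i)) :
    ∃ K, LipschitzWith K fun u : Lifted H n => liftLin G G' Z u + liftB τ β G G'' B u := by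
  lift β to NNReal using hβ.le
  have hB' := lipschitzWith_diagB (NNReal.coe_pos.1 hβ) hB
  let e := (WithLp.prodContinuousLinearEquiv 2 ℝ (Pow H n) (Pow H (n - 1)))
  let f := (ContinuousLinearMap.fst ℝ (Pow H n) (Pow H (n - 1))).comp e.toContinuousLinearMap
  let s := (ContinuousLinearMap.snd ℝ (Pow H n) (Pow H (n - 1))).comp e.toContinuousLinearMap
  let ι := e.symm.toContinuousLinearMap.comp
    (ContinuousLinearMap.inl ℝ (Pow H n) (Pow H (n - 1)))
  -- Everything linear, including the `P(G)` term of the second operator; only `diagB` remains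
  -- outside.
  let L := e.symm.toContinuousLinearMap.comp
    (((kronL (matP (G \ G'))).comp f + (kronL (matQ G')).comp f - (kronL Z).comp s
      + (τ / (4 * β)) • (kronL (matP G)).comp f).prod ((kronL Z.transpose).comp f))
  have h := L.lipschitz.add ((τ • ι).lipschitz.comp
    (hB'.comp ((kronL (adj G'').transpose).comp f).lipschitz))
  refine ⟨_, (congrArg (LipschitzWith _) (funext fun u => ?_)).mp h⟩
  apply WithLp.ofLp_injective
  refine Prod.ext ?_ ?_
  · simp only [liftLin, liftB, ← WithLp.toLp_add]
    change (_ + _ - _ + _) + τ • opBD G'' B u.fst = (_ + _ - _) + (τ • opBD G'' B u.fst + _)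
    rw [add_assoc, add_comm (τ • _)]
    rfl
  · change _ + τ • (0 : Pow H (n - 1)) = _ + 0
    rw [smul_zero]
    rfl

theorem isMaximallyMonotone_lifted [CompleteSpace H] {τ β : ℝ} (hτ : 0 < τ) (hβ : 0 < β)
    {A : Fin n → H → Set H} (hA : ∀ i, IsMaximallyMonotone (A i)) {B : Fin (n - 1) → H → H}
    (hB : ∀ i, IsCocoercive β (B i)) {G G'' : Digraph (Fin n)} (G' : Digraph (Fin n))
    (hG'' : G'' ≤ G) (hin : ∀ i : Fin n, 1 ≤ i.val → inDeg G'' i = 1)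
    (Z : Matrix (Fin n) (Fin (n - 1)) ℝ) :
    IsMaximallyMonotone (liftA τ G G' Z A + ofFun (liftB τ β G G'' B)) := by
  obtain ⟨K, hK⟩ := exists_lipschitzWith_liftLin_add_liftB τ hβ G G' G'' Z hB
  rw [liftA_add_ofFun_liftB]
  refine (isMonotone_liftDiag hτ.le fun i => (hA i).1).isMaximallyMonotone_add_ofFun
    (fun μ hμ => exists_sub_smul_mem_liftDiag hτ hA hμ) (fun x y => ?_) hK
  rw [add_sub_add_comm, inner_add_right, liftLin_sub]
  exact add_nonneg (inner_liftLin_nonneg _ _ _ _) (liftB_monotone hτ.le hβ hB hG'' hin x y)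

/-! ### Zeros of the lifted operator -/

theorem mem_zer_sum_iff {E ι κ : Type*} [AddCommGroup E] [Fintype ι] [Fintype κ] {A : ι → E → Set E}
    {B : κ → E → E} {z : E} : z ∈ zer (∑ i, A i + ∑ i, ofFun (B i)) ↔
      ∃ a : ι → E, (∀ i, a i ∈ A i z) ∧ ∑ i, a i + ∑ i, B i z = 0 := by
  have h : (∑ i, ofFun (B i)) z = {∑ i, B i z} := by
    rw [Finset.sum_apply]
    exact Set.finsetSum_singleton _ _
  change 0 ∈ (∑ i, A i) z + (∑ i, ofFun (B i)) z ↔ _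
  simp only [h, Finset.sum_apply, Set.add_singleton, Set.mem_image, Set.mem_fintype_sum]
  constructor
  · rintro ⟨_, ⟨a, ha, rfl⟩, h0⟩
    exact ⟨a, ha, h0⟩
  · rintro ⟨a, ha, h0⟩
    exact ⟨_, ⟨a, ha, rfl⟩, h0⟩

theorem sum_opBD_const (hn : n ≠ 0) {G'' : Digraph (Fin n)}
    (hin : ∀ i : Fin n, 1 ≤ i.val → inDeg G'' i = 1) (B : Fin (n - 1) → H → H) {x : Pow H n}
    {z : H} (hx : ∀ i, x i = z) : ∑ i, opBD G'' B x i = ∑ i, B i z := by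
  obtain ⟨m, rfl⟩ := Nat.exists_eq_succ_of_ne_zero hn
  rw [Fin.sum_univ_succ]
  have h0 : opBD G'' B x 0 = 0 := by simp [opBD, diagB]
  rw [h0, zero_add]
  refine Finset.sum_congr rfl fun i _ => ?_
  obtain ⟨p, -, hcol⟩ := exists_adj_col_eq (hin i.succ (by simp))
  rw [opBD_apply hcol (by simp), hx]
  rfl

theorem exists_mem_zer_lifted_iff (hn : n ≠ 0) {τ : ℝ} (hτ : 0 < τ) (β : ℝ)
    (A : Fin n → H → Set H) (B : Fin (n - 1) → H → H) (G : Digraph (Fin n))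
    {G' G'' : Digraph (Fin n)} (hlt : ∀ i j, G'.Adj i j → i < j) (hconn : IsConnected G')
    (hin : ∀ i : Fin n, 1 ≤ i.val → inDeg G'' i = 1)
    {Z : Matrix (Fin n) (Fin (n - 1)) ℝ} (hZ : lap G' = Z * Z.transpose) (x : Pow H n) :
    (∃ v : Pow H (n - 1), (WithLp.toLp 2 (x, v) : Lifted H n) ∈
        zer (liftA τ G G' Z A + ofFun (liftB τ β G G'' B))) ↔
      ∃ z : H, (∀ i, x i = z) ∧ z ∈ zer (∑ i, A i + ∑ i, ofFun (B i)) := by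
  have hone : Z.transpose.mulVec (fun _ => 1) = 0 :=
    (transpose_mulVec_eq_zero_iff_const hlt hconn hZ _).2 fun _ _ => rfl
  -- The vector that `Z v` must equal for the first row to vanish.
  set r : Pow H n → Pow H n := fun a => τ • a + kron (matP (G \ G')) x + kron (matQ G') x
    + (τ • opBD G'' B x + (τ / (4 * β)) • kron (matP G) x) with hr
  have hmem : ∀ v : Pow H (n - 1), (WithLp.toLp 2 (x, v) : Lifted H n) ∈
      zer (liftA τ G G' Z A + ofFun (liftB τ β G G'' B)) ↔
      (∃ a ∈ diagA A x, kron Z v = r a) ∧ kron Z.transpose x = 0 := by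
    intro v
    have h1 : ∀ a : Pow H n, 0 - liftB τ β G G'' B (WithLp.toLp 2 (x, v)) =
        WithLp.toLp 2 (τ • a + kron (matP (G \ G')) x + kron (matQ G') x - kron Z v,
          kron Z.transpose x) ↔ kron Z v = r a ∧ kron Z.transpose x = 0 := by
      intro a
      rw [sub_eq_iff_eq_add, liftB, lifted_add, eq_comm, add_zero]
      refine (WithLp.toLp_injective 2).eq_iff.trans (Prod.mk_eq_zero.trans ?_)
      rw [sub_add_eq_add_sub, sub_eq_zero, eq_comm]
      exact Iff.rfl
    rw [zer, Set.mem_ofPred_eq, mem_add_ofFun]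
    constructor
    · rintro ⟨a, ha, h⟩
      exact ⟨⟨a, ha, ((h1 a).1 h).1⟩, ((h1 a).1 h).2⟩
    · rintro ⟨⟨a, ha, h⟩, h0⟩
      exact ⟨a, ha, (h1 a).2 ⟨h, h0⟩⟩
  have hsum : ∀ z, (∀ i, x i = z) → ∀ a : Pow H n,
      ∑ i, r a i = τ • (∑ i, a i + ∑ i, B i z) := by
    intro z hx a
    simp only [hr, PiLp.add_apply, PiLp.smul_apply, Finset.sum_add_distrib, ← Finset.smul_sum,
      sum_kron_const _ hx, sum_sum_matP, sum_sum_matQ, sum_opBD_const hn hin B hx, zero_smul,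
      smul_zero, add_zero, smul_add]
  simp only [hmem]
  constructor
  · rintro ⟨v, ⟨a, ha, hv⟩, h0⟩
    have hx : ∀ i, x i = x ⟨0, Nat.pos_of_ne_zero hn⟩ := fun i =>
      (kron_transpose_eq_zero_iff hlt hconn hZ x).1 h0 _ _
    refine ⟨_, hx, mem_zer_sum_iff.2 ⟨a, fun i => hx i ▸ ha i, ?_⟩⟩
    have h1 := hsum _ hx a
    -- The columns of `Z` sum to zero, so summing over the nodes eliminates `v`.
    rw [← hv, sum_kron_eq_zero hone] at h1
    exact (smul_eq_zero.1 h1.symm).resolve_left hτ.ne'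
  · rintro ⟨z, hx, hz⟩
    obtain ⟨a, ha, h0⟩ := mem_zer_sum_iff.1 hz
    obtain ⟨v, hv⟩ := exists_kron_eq hn hlt hconn hZ (w := r (WithLp.toLp 2 a)) (by
      rw [hsum z hx]
      simp only [h0, smul_zero])
    refine ⟨v, ⟨WithLp.toLp 2 a, fun i => ?_, hv⟩, ?_⟩
    · rw [hx]
      exact ha i
    · exact (kron_transpose_eq_zero_iff hlt hconn hZ x).2 fun i j => (hx i).trans (hx j).symm

end Lifted

end GraphFB

theorem theorem3p1 {H : Type*} [NormedAddCommGroup H] [InnerProductSpace ℝ H] [CompleteSpace H]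
    (n : ℕ) (hn : 2 ≤ n)
    (A : Fin n → H → Set H) (hA : ∀ i, GraphFB.IsMaximallyMonotone (A i))
    (β : ℝ) (hβ : 0 < β)
    (B : Fin (n - 1) → H → H) (hB : ∀ i, GraphFB.IsCocoercive β (B i))
    (hzer : (GraphFB.zer (∑ i, A i + ∑ i, GraphFB.ofFun (B i))).Nonempty)
    (G G' G'' : Digraph (Fin n))
    (hG : GraphFB.IsAlgorithmic G)
    (hG' : G' ≤ G) (hG'conn : GraphFB.IsConnected G')
    (hG'' : G'' ≤ G) (hG''in : ∀ i : Fin n, 1 ≤ i.val → GraphFB.inDeg G'' i = 1)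
    (Z : Matrix (Fin n) (Fin (n - 1)) ℝ) (hZ : GraphFB.lap G' = Z * Z.transpose)
    (τ : ℝ) (hτ : 0 < τ) :
    (∀ x : GraphFB.Pow H n,
      (∃ v : GraphFB.Pow H (n - 1),
        (WithLp.toLp 2 (x, v) : GraphFB.Lifted H n) ∈
          GraphFB.zer
            (GraphFB.liftA τ G G' Z A + GraphFB.ofFun (GraphFB.liftB τ β G G'' B))) ↔
      ∃ z : H, (∀ i, x i = z) ∧ z ∈ GraphFB.zer (∑ i, A i + ∑ i, GraphFB.ofFun (B i))) ∧
    GraphFB.IsMaximallyMonotone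
      (GraphFB.liftA τ G G' Z A + GraphFB.ofFun (GraphFB.liftB τ β G G'' B)) := by
  exact ⟨GraphFB.exists_mem_zer_lifted_iff (by omega) hτ β A B G
    (fun i j h => hG.2.1 i j (hG' h)) hG'conn hG''in hZ,
    GraphFB.isMaximallyMonotone_lifted hτ hβ hA hB G' hG'' hG''in Z⟩
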